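/- Let $E$ be a non-trivial locally convex Hausdorff space over $\mathbb{C}$ which is locally complete, i.e. for every non-empty closed bounded absolutely convex set $D\subset E$ the space $E_D=\bigcup_{n\in\mathbb{N}} nD$, normed by the gauge of $D$, is a Banach space. Let $z_0\in\mathbb{C}$, $r\in(0,\infty]$, and let $\mathbb{D}_r(z_0)=\{z\in\mathbb{C} : |z-z_0|<r\}$. Let $\mathcal{O}(\mathbb{D}_r(z_0),E)$ be the space of all functions $f\colon \mathbb{D}_r(z_0)\to E$ such that the limit $\partial_{\mathbb{C}}f(z)=\lim_{h\to0,\,h\ne0}\frac{f(z+h)-f(z)}{h}$ exists in $E$ for every $z\in\mathbb{D}_r(z_0)$, equipped with the topology of uniform convergence on compact subsets of $\mathbb{D}_r(z_0)$. Put $\partial^0_{\mathbb{C}}f=f$ and $\partial^{n+1}_{\mathbb{C}}f=\partial_{\mathbb{C}}(\partial^n_{\mathbb{C}}f)$. Then the following holds. 1. For every $f\in\mathcal{O}(\mathbb{D}_r(z_0),E)$ and $n\in\mathbb{N}_0$ the derivative $\partial^n_{\mathbb{C}}f$ exists on $\mathbb{D}_r(z_0)$ and belongs to $\mathcal{O}(\mathbb{D}_r(z_0),E)$.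 2. The maps $$P_k f=\sum_{n=0}^{k}\frac{(\partial^n_{\mathbb{C}}f)(z_0)}{n!}(\cdot-z_0)^n,\qquad k\in\mathbb{N}_0,$$ form a Schauder decomposition of $\mathcal{O}(\mathbb{D}_r(z_0),E)$. That is, they are continuous linear projections of $\mathcal{O}(\mathbb{D}_r(z_0),E)$ into itself with $P_kP_j=P_{\min(j,k)}$ for all $j,k$, with $P_k\neq P_j$ for $k\neq j$, and with $P_kf\to f$ in $\mathcal{O}(\mathbb{D}_r(z_0),E)$ as $k\to\infty$ for every $f$. 3. Every $f\in\mathcal{O}(\mathbb{D}_r(z_0),E)$ satisfies $$f=\sum_{n=0}^{\infty}\frac{(\partial^n_{\mathbb{C}}f)(z_0)}{n!}(\cdot-z_0)^n,$$ where the partial sums of the series converge in $\mathcal{O}(\mathbb{D}_r(z_0),E)$. -/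

import Mathlib

open Filter Topology
open scoped ENNReal Nat

noncomputable section

/-- A closed disk in a complex topological vector space: a closed, bounded, absolutely convex
(that is, balanced and convex) non-empty set. -/
structure IsClosedDisk {E : Type*} [AddCommGroup E] [Module ℂ E] [TopologicalSpace E]
    (D : Set E) : Prop where
  nonempty : D.Nonempty
  isClosed : IsClosed D
  isVonNBounded : Bornology.IsVonNBounded ℂ D
  balanced : Balanced ℂ D
  convex : Convex ℝ D

/-- A complex locally convex space `E` is locally complete if for every closed disk `D` the space
`E_D = ⋃ₙ n D`, normed by the gauge of `D`, is a Banach space: every sequence in `E_D` which is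
Cauchy for the gauge of `D` converges for the gauge of `D` to an element of `E_D`.
As `D` is absolutely convex, `E_D` is the linear span of `D`. -/
def IsLocallyComplete (E : Type*) [AddCommGroup E] [Module ℂ E] [TopologicalSpace E] : Prop :=
  ∀ D : Set E, IsClosedDisk D → ∀ u : ℕ → E, (∀ n, u n ∈ Submodule.span ℂ D) →
    (∀ ε : ℝ, 0 < ε → ∃ N : ℕ, ∀ m ≥ N, ∀ n ≥ N, gauge D (u m - u n) < ε) →
    ∃ x ∈ Submodule.span ℂ D, Tendsto (fun n => gauge D (u n - x)) atTop (𝓝 0)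

/-- A sequence of maps `P k : F → F` is a Schauder decomposition of the topological vector space
`F` if the `P k` are continuous linear, satisfy `P k ∘ P j = P (min j k)` (in particular they are
projections), are pairwise different, and `P k f → f` for every `f`. -/
structure IsSchauderDecomposition (𝕜 : Type*) {F : Type*} [Semiring 𝕜] [AddCommMonoid F]
    [Module 𝕜 F] [TopologicalSpace F] (P : ℕ → F → F) : Prop where
  isLinearMap : ∀ k, IsLinearMap 𝕜 (P k)
  continuous : ∀ k, Continuous (P k)
  comp_eq : ∀ k j, P k ∘ P j = P (min j k)
  ne : ∀ k j, k ≠ j → P k ≠ P j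
  tendsto : ∀ f, Tendsto (fun k => P k f) atTop (𝓝 f)

section Holomorphic

variable {E : Type*} [AddCommGroup E] [Module ℂ E] [TopologicalSpace E] {U : Set ℂ}

/-- `d` is the complex derivative of `f : U → E` at `z`: the difference quotients
`(f w - f z) / (w - z)` converge to `d` in `E` as `w → z` in `U`, `w ≠ z`. -/
def HasComplexDerivAt (f : U → E) (d : E) (z : U) : Prop :=
  Tendsto (fun w : U => ((w : ℂ) - (z : ℂ))⁻¹ • (f w - f z)) (𝓝[≠] z) (𝓝 d)

/-- `f : U → E` is holomorphic if it has a complex derivative at every point of `U`. -/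
def IsHolomorphic (f : U → E) : Prop :=
  ∀ z : U, ∃ d : E, HasComplexDerivAt f d z

/-- The complex derivative of `f : U → E`, as a limit of difference quotients. -/
def complexDeriv (f : U → E) : U → E := fun z =>
  limUnder (𝓝[≠] z) fun w : U => ((w : ℂ) - (z : ℂ))⁻¹ • (f w - f z)

/-- The complex derivatives of higher order, by recursion. -/
def iteratedComplexDeriv : ℕ → (U → E) → U → E
  | 0, f => f
  | n + 1, f => complexDeriv (iteratedComplexDeriv n f)

variable [IsTopologicalAddGroup E] [ContinuousSMul ℂ E]

/-- Holomorphic functions are continuous. -/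
theorem IsHolomorphic.continuous {f : U → E} (hf : IsHolomorphic f) : Continuous f := by
  rw [continuous_iff_continuousAt]
  intro z
  obtain ⟨d, hd⟩ := hf z
  rw [continuousAt_iff_punctured_nhds]
  have h1 : Tendsto (fun w : U => (w : ℂ) - (z : ℂ)) (𝓝[≠] z) (𝓝 0) := by
    have h : Continuous fun w : U => (w : ℂ) - (z : ℂ) := by fun_prop
    simpa using (h.tendsto z).mono_left nhdsWithin_le_nhds
  have h2 := (h1.smul hd).add_const (f z)
  rw [zero_smul, zero_add] at h2
  refine h2.congr' ?_
  filter_upwards [self_mem_nhdsWithin] with w hw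
  have hw' : (w : ℂ) - (z : ℂ) ≠ 0 := sub_ne_zero.2 fun h => hw (Subtype.ext h)
  rw [smul_inv_smul₀ hw', sub_add_cancel]

/-- The space `𝒪(U, E)` of holomorphic functions `U → E`, with the compact-open topology, i.e.
the topology of uniform convergence on compact subsets of `U`, which is the one it inherits
from the space `C(U, E)` of continuous functions. Holomorphic functions being continuous
(`IsHolomorphic.continuous`), every holomorphic function is an element. -/
def HolomorphicFunctions (U : Set ℂ) (E : Type*) [AddCommGroup E] [Module ℂ E]
    [TopologicalSpace E] [IsTopologicalAddGroup E] [ContinuousSMul ℂ E] :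
    Submodule ℂ C(U, E) where
  carrier := {f | IsHolomorphic f}
  zero_mem' z := ⟨0, by simpa [HasComplexDerivAt] using tendsto_const_nhds⟩
  add_mem' {f g} hf hg z := by
    obtain ⟨a, ha⟩ := hf z
    obtain ⟨b, hb⟩ := hg z
    refine ⟨a + b, (ha.add hb).congr fun w => ?_⟩
    simp only [ContinuousMap.add_apply]
    rw [← smul_add]
    congr 1
    abel
  smul_mem' c f hf z := by
    obtain ⟨a, ha⟩ := hf z
    refine ⟨c • a, (ha.const_smul c).congr fun w => ?_⟩
    simp only [ContinuousMap.smul_apply]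
    rw [smul_comm, smul_sub]

/-- The functions `z ↦ (z - a)ⁿ e` are holomorphic. -/
theorem isHolomorphic_monomial (a : ℂ) (n : ℕ) (e : E) :
    IsHolomorphic fun z : U => ((z : ℂ) - a) ^ n • e := by
  intro z
  have h1 : HasDerivAt (fun w : ℂ => (w - a) ^ n) ((n : ℂ) * ((z : ℂ) - a) ^ (n - 1)) z := by
    have h := ((hasDerivAt_id (z : ℂ)).sub_const a).pow n
    rw [mul_one] at h
    exact h
  have h2 : Tendsto (Subtype.val : U → ℂ) (𝓝[≠] z) (𝓝[≠] (z : ℂ)) :=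
    tendsto_nhdsWithin_iff.2 ⟨(continuous_subtype_val.tendsto z).mono_left nhdsWithin_le_nhds, by
      filter_upwards [self_mem_nhdsWithin] with w hw
      exact fun h => hw (Subtype.ext h)⟩
  refine ⟨_, (((hasDerivAt_iff_tendsto_slope.1 h1).comp h2).smul_const e).congr fun w => ?_⟩
  simp only [Function.comp_apply, slope, vsub_eq_sub, smul_eq_mul]
  rw [mul_smul, sub_smul]

/-- The `n`-th term `((∂ⁿ f)(z₀) / n!) (· - z₀)ⁿ` of the power series of `f` at `z₀`. -/
def powerSeriesTerm (z₀ : U) (n : ℕ) (f : HolomorphicFunctions U E) : HolomorphicFunctions U E :=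
  ⟨⟨fun z => ((z : ℂ) - (z₀ : ℂ)) ^ n • ((n ! : ℂ)⁻¹ • iteratedComplexDeriv n f.1 z₀),
    (isHolomorphic_monomial _ n _).continuous⟩, isHolomorphic_monomial _ n _⟩

/-- The partial sum `∑_{n=0}^k ((∂ⁿ f)(z₀) / n!) (· - z₀)ⁿ` of the power series of `f` at `z₀`. -/
def powerSeriesPartialSum (z₀ : U) (k : ℕ) (f : HolomorphicFunctions U E) :
    HolomorphicFunctions U E :=
  ∑ n ∈ Finset.range (k + 1), powerSeriesTerm z₀ n f

end Holomorphic

end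

/-! Locally, a holomorphic `f` is a Banach-valued holomorphic function followed by a continuous
linear map (`IsHolomorphic.exists_factorization`); everything analytic is then pushed forward from
the Banach space.

Let `S` be the image under `f` of a closed disk of radius `R` in `U`. It is compact, hence bounded,
and so is its bipolar `D`; local completeness makes the span of `D` a Banach space with norm the
gauge of `D` (`IsClosedDisk.exists_banach`). If `ℓ` is bounded by `1` on `S`, Cauchy's estimate
makes `ℓ ∘ f` Lipschitz on the disk of radius `ρ < R`, with constant `1 / (R - ρ)` independent of
`ℓ`. By definition of the bipolar, `f` is then Lipschitz for the gauge of `D`. So the lift `g` of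
`f` is continuous, its Cauchy integral exists and is holomorphic, and functionals on `E`, which
separate points, identify the image of that integral with `f`.

Existence of derivatives follows from `iteratedComplexDeriv_eq_of_factorization`, and compact
convergence of the series from `tendstoUniformlyOn_taylorSeries`. Continuity of the coefficients is
Cauchy's estimate for `ℓ ∘ f` combined with the bipolar theorem; the projection identities come from
the derivatives of monomials at their centre. -/

open scoped Pointwise

noncomputable section

/-! ### The normed space spanned by a closed disk -/

section DiskSpan

variable {E : Type*} [AddCommGroup E] [Module ℂ E]

/-- The linear span `E_D` of a set `D`, without the topology inherited from `E`. -/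
def DiskSpan (D : Set E) : Type _ := Submodule.span ℂ D

namespace DiskSpan

variable (D : Set E)

instance : AddCommGroup (DiskSpan D) := inferInstanceAs (AddCommGroup (Submodule.span ℂ D))

instance : Module ℂ (DiskSpan D) := inferInstanceAs (Module ℂ (Submodule.span ℂ D))

/-- The inclusion of `E_D` into `E`. -/
def incl : DiskSpan D →ₗ[ℂ] E := (Submodule.span ℂ D).subtype

theorem incl_injective : Function.Injective (incl D) := Subtype.val_injective

variable {D}

theorem incl_mem_span (x : DiskSpan D) : incl D x ∈ Submodule.span ℂ D := x.2

theorem exists_incl_eq {x : E} (hx : x ∈ Submodule.span ℂ D) : ∃ y, incl D y = x := ⟨⟨x, hx⟩, rfl⟩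

theorem gauge_preimage (x : DiskSpan D) : gauge (incl D ⁻¹' D) x = gauge D (incl D x) := by
  rw [gauge_def', gauge_def']
  rfl

end DiskSpan

/-- A point of the span of a convex balanced set lies in a multiple of it. -/
theorem exists_mem_smul_of_mem_span {D : Set E} (hne : D.Nonempty) (hb : Balanced ℂ D)
    (hc : Convex ℝ D) {x : E} (hx : x ∈ Submodule.span ℂ D) : ∃ t : ℝ, 0 < t ∧ x ∈ t • D := by
  induction hx using Submodule.span_induction with
  | mem x hx => exact ⟨1, one_pos, by simpa using hx⟩
  | zero =>
    refine ⟨1, one_pos, ?_⟩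
    obtain ⟨y, hy⟩ := hne
    simpa using hb.smul_mem (a := 0) (by simp) hy
  | add x y _ _ hx hy =>
    obtain ⟨s, hs, hx⟩ := hx
    obtain ⟨t, ht, hy⟩ := hy
    exact ⟨s + t, by positivity, by
      rw [hc.add_smul hs.le ht.le]; exact Set.add_mem_add hx hy⟩
  | smul a x _ hx =>
    obtain ⟨s, hs, y, hy, rfl⟩ := hx
    -- The factor `‖a‖ + 1` rather than `‖a‖` keeps the multiple positive when `a = 0`.
    refine ⟨(‖a‖ + 1) * s, by positivity, ((‖a‖ + 1 : ℝ) : ℂ)⁻¹ • a • y, ?_, ?_⟩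
    · rw [smul_smul]
      refine hb.smul_mem ?_ hy
      rw [norm_mul, norm_inv, Complex.norm_real, Real.norm_of_nonneg (by positivity),
        inv_mul_le_iff₀ (by positivity)]
      linarith
    · have h : ((‖a‖ + 1 : ℝ) : ℂ) ≠ 0 := by
        exact_mod_cast (by positivity : (0 : ℝ) < ‖a‖ + 1).ne'
      simp only [← Complex.coe_smul, smul_smul]
      congr 1
      push_cast at h ⊢
      field_simp

variable [TopologicalSpace E] {D : Set E}

/-- `D` need not absorb `E`, only its own span; pulling it back there is what makes its gauge a
seminorm. -/
theorem IsClosedDisk.absorbent_preimage (hD : IsClosedDisk D) :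
    Absorbent ℝ (DiskSpan.incl D ⁻¹' D) := by
  refine absorbent_iff_inv_smul.2 fun x => ?_
  obtain ⟨t, ht, y, hy, hxy⟩ :=
    exists_mem_smul_of_mem_span hD.nonempty hD.balanced hD.convex x.incl_mem_span
  filter_upwards [tendsto_norm_cobounded_atTop.eventually_ge_atTop t] with c hc
  have h : DiskSpan.incl D (c⁻¹ • x) = ((c⁻¹ * t : ℝ) : ℂ) • y := by
    have h1 := (DiskSpan.incl D).map_smul ((c⁻¹ : ℝ) : ℂ) x
    rw [← hxy] at h1
    dsimp only at h1
    rw [← Complex.coe_smul t y, smul_smul] at h1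
    push_cast at h1 ⊢
    rw [← h1, ← Complex.coe_smul, Complex.ofReal_inv]
  rw [Set.mem_preimage, h]
  refine hD.balanced.smul_mem ?_ hy
  rw [Complex.norm_real, norm_mul, norm_inv, Real.norm_of_nonneg ht.le,
    inv_mul_le_iff₀ (ht.trans_le hc), mul_one]
  exact hc

theorem IsClosedDisk.balanced_preimage (hD : IsClosedDisk D) :
    Balanced ℂ (DiskSpan.incl D ⁻¹' D) := by
  refine balanced_iff_smul_mem.2 fun a ha x hx => ?_
  rw [Set.mem_preimage, map_smul]
  exact hD.balanced.smul_mem ha hx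

theorem IsClosedDisk.convex_preimage (hD : IsClosedDisk D) :
    Convex ℝ (DiskSpan.incl D ⁻¹' D) :=
  hD.convex.linear_preimage ((DiskSpan.incl D).restrictScalars ℝ)

/-- The gauge of a closed disk, as a seminorm on its span. -/
def IsClosedDisk.seminorm (hD : IsClosedDisk D) : Seminorm ℂ (DiskSpan D) :=
  gaugeSeminorm hD.balanced_preimage hD.convex_preimage hD.absorbent_preimage

theorem IsClosedDisk.seminorm_apply (hD : IsClosedDisk D) (x : DiskSpan D) :
    hD.seminorm x = gauge D (DiskSpan.incl D x) := DiskSpan.gauge_preimage x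

theorem IsClosedDisk.mem_smul_of_seminorm_lt (hD : IsClosedDisk D) {x : DiskSpan D} {t : ℝ}
    (h : hD.seminorm x < t) : DiskSpan.incl D x ∈ t • D := by
  obtain ⟨b, hb, hbt, y, hy, rfl⟩ := exists_lt_of_gauge_lt hD.absorbent_preimage h
  refine ⟨((t⁻¹ * b : ℝ) : ℂ) • DiskSpan.incl D y, hD.balanced.smul_mem ?_ hy, ?_⟩
  · rw [Complex.norm_real, Real.norm_of_nonneg (by have := hb.trans hbt; positivity),
      inv_mul_le_iff₀ (hb.trans hbt), mul_one]
    exact hbt.le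
  · have h1 := (DiskSpan.incl D).map_smul (b : ℂ) y
    have h2 : (t : ℂ) ≠ 0 := by exact_mod_cast (hb.trans hbt).ne'
    simp only [← Complex.coe_smul, smul_smul]
    rw [h1]
    push_cast
    rw [mul_inv_cancel_left₀ h2]

/-- A point of gauge zero lies in every positive multiple of `D`. If it were non-zero, its
complement would be a neighbourhood of `0` absorbing the bounded set `D`, and a small enough
multiple of `D` would miss the point. -/
theorem IsClosedDisk.seminorm_eq_zero [T1Space E] (hD : IsClosedDisk D) {x : DiskSpan D}
    (h : hD.seminorm x = 0) : x = 0 := by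
  by_contra hx
  have hx' : DiskSpan.incl D x ≠ 0 := fun h0 => hx (DiskSpan.incl_injective D (by simpa using h0))
  have hV : {DiskSpan.incl D x}ᶜ ∈ 𝓝 (0 : E) := isOpen_compl_singleton.mem_nhds hx'.symm
  obtain ⟨r, hr⟩ := absorbs_iff_norm.1 (hD.isVonNBounded hV)
  have hr0 : 0 < |r| + 1 := by positivity
  obtain ⟨d, hd, hdx⟩ := hD.mem_smul_of_seminorm_lt (t := (|r| + 1)⁻¹) (by rw [h]; positivity)
  obtain ⟨v, hv, hvd⟩ := hr ((|r| + 1 : ℝ) : ℂ) (by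
    rw [Complex.norm_real, Real.norm_of_nonneg hr0.le]
    exact (le_abs_self r).trans (by linarith)) hd
  refine hv ?_
  rw [Set.mem_singleton_iff, ← hdx, ← hvd]
  simp only [Complex.coe_smul]
  rw [inv_smul_smul₀ hr0.ne']

universe u in
/-- In a locally complete space, every closed disk is the image of the closed unit ball under an
injective continuous linear map from a Banach space. -/
theorem IsClosedDisk.exists_banach {E : Type u} [AddCommGroup E] [Module ℂ E]
    [TopologicalSpace E] {D : Set E} [IsTopologicalAddGroup E] [ContinuousSMul ℂ E] [T1Space E]
    (hE : IsLocallyComplete E) (hD : IsClosedDisk D) :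
    ∃ (F : Type u) (_ : NormedAddCommGroup F) (_ : NormedSpace ℂ F) (_ : CompleteSpace F)
      (ι : F →L[ℂ] E), Function.Injective ι ∧
        ∀ t : ℝ, 0 ≤ t → ∀ x ∈ t • D, ∃ y, ‖y‖ ≤ t ∧ ι y = x := by
  let _ : Norm (DiskSpan D) := ⟨hD.seminorm⟩
  have hnorm (x : DiskSpan D) : ‖x‖ = hD.seminorm x := rfl
  have core : NormedSpace.Core ℂ (DiskSpan D) :=
    { norm_nonneg := fun x => apply_nonneg hD.seminorm x
      norm_smul := fun c x => map_smul_eq_mul hD.seminorm c x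
      norm_triangle := fun x y => map_add_le_add hD.seminorm x y
      norm_eq_zero_iff := fun x => ⟨hD.seminorm_eq_zero, fun h => by rw [h, hnorm, map_zero]⟩ }
  let _ : NormedAddCommGroup (DiskSpan D) := NormedAddCommGroup.ofCore core
  let _ : NormedSpace ℂ (DiskSpan D) := NormedSpace.ofCore core
  -- The open unit ball lands in the bounded set `D`, which makes the inclusion continuous.
  have hbdd : ∃ V ∈ 𝓝 (0 : DiskSpan D), Bornology.IsVonNBounded ℂ (DiskSpan.incl D '' V) := by
    refine ⟨Metric.ball 0 1, Metric.ball_mem_nhds _ one_pos, hD.isVonNBounded.subset ?_⟩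
    rintro _ ⟨x, hx, rfl⟩
    have hx' : hD.seminorm x < 1 := by simpa [hnorm] using hx
    simpa using hD.mem_smul_of_seminorm_lt hx'
  have hcomplete : CompleteSpace (DiskSpan D) := by
    refine Metric.complete_of_cauchySeq_tendsto fun u hu => ?_
    obtain ⟨x, hx, hux⟩ := hE D hD (fun n => DiskSpan.incl D (u n)) (fun n => (u n).incl_mem_span)
      (by simpa [Metric.cauchySeq_iff, dist_eq_norm, hnorm, hD.seminorm_apply] using hu)
    obtain ⟨y, rfl⟩ := DiskSpan.exists_incl_eq hx
    exact ⟨y, tendsto_iff_norm_sub_tendsto_zero.2 (by simpa [hnorm, hD.seminorm_apply] using hux)⟩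
  refine ⟨DiskSpan D, inferInstance, inferInstance, hcomplete,
    (DiskSpan.incl D).clmOfExistsBoundedImage hbdd, DiskSpan.incl_injective D, fun t ht x hx => ?_⟩
  have hxs : x ∈ Submodule.span ℂ D := by
    obtain ⟨d, hd, rfl⟩ := hx
    simp only [← Complex.coe_smul]
    exact Submodule.smul_mem _ _ (Submodule.subset_span hd)
  obtain ⟨y, rfl⟩ := DiskSpan.exists_incl_eq hxs
  exact ⟨y, by rw [hnorm, hD.seminorm_apply]; exact gauge_le_of_mem ht hx, rfl⟩

end DiskSpan

/-! ### Bipolars -/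

section Bipolar

variable {E : Type*} [AddCommGroup E] [Module ℂ E] [TopologicalSpace E]

/-- The absolute bipolar of a set in a complex topological vector space. -/
def bipolarHull (S : Set E) : Set E :=
  {y | ∀ ℓ : E →L[ℂ] ℂ, (∀ x ∈ S, ‖ℓ x‖ ≤ 1) → ‖ℓ y‖ ≤ 1}

theorem mem_bipolarHull {S : Set E} {y : E} :
    y ∈ bipolarHull S ↔ ∀ ℓ : E →L[ℂ] ℂ, (∀ x ∈ S, ‖ℓ x‖ ≤ 1) → ‖ℓ y‖ ≤ 1 := Iff.rfl

theorem subset_bipolarHull (S : Set E) : S ⊆ bipolarHull S := by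
  intro x hx
  rw [mem_bipolarHull]
  exact fun ℓ hℓ => hℓ x hx

theorem isClosed_bipolarHull (S : Set E) : IsClosed (bipolarHull S) := by
  have h : bipolarHull S = ⋂ (ℓ : E →L[ℂ] ℂ) (_ : ∀ x ∈ S, ‖ℓ x‖ ≤ 1), {y | ‖ℓ y‖ ≤ 1} := by
    ext y
    simp [mem_bipolarHull]
  rw [h]
  exact isClosed_iInter fun ℓ => isClosed_iInter fun _ =>
    isClosed_le ℓ.continuous.norm continuous_const

theorem balanced_bipolarHull (S : Set E) : Balanced ℂ (bipolarHull S) :=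
  balanced_iff_smul_mem.2 fun a ha x hx => mem_bipolarHull.2 fun ℓ hℓ => by
    rw [map_smul, norm_smul]
    exact mul_le_one₀ ha (norm_nonneg _) (hx ℓ hℓ)

theorem convex_bipolarHull (S : Set E) : Convex ℝ (bipolarHull S) := by
  intro x hx y hy a b ha hb hab
  refine mem_bipolarHull.2 fun ℓ hℓ => ?_
  have h : ‖a • ℓ x + b • ℓ y‖ ≤ a * 1 + b * 1 := by
    refine (norm_add_le _ _).trans ?_
    rw [norm_smul, norm_smul, Real.norm_of_nonneg ha, Real.norm_of_nonneg hb]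
    gcongr
    exacts [hx ℓ hℓ, hy ℓ hℓ]
  rw [mul_one, mul_one, hab] at h
  rwa [← Complex.coe_smul, ← Complex.coe_smul, map_add, map_smul, map_smul, Complex.coe_smul,
    Complex.coe_smul]

/-- Turns scalar estimates uniform over the polar of `S` into estimates for the gauge of the
bipolar. -/
theorem mem_smul_bipolarHull {S : Set E} {t : ℝ} (ht : 0 < t) {x : E}
    (h : ∀ ℓ : E →L[ℂ] ℂ, (∀ x ∈ S, ‖ℓ x‖ ≤ 1) → ‖ℓ x‖ ≤ t) : x ∈ t • bipolarHull S := by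
  rw [Set.mem_smul_set_iff_inv_smul_mem₀ ht.ne', ← Complex.coe_smul, mem_bipolarHull]
  intro ℓ hℓ
  rw [map_smul, norm_smul, Complex.norm_real, norm_inv, Real.norm_of_nonneg ht.le,
    inv_mul_le_iff₀ ht, mul_one]
  exact h ℓ hℓ

variable [IsTopologicalAddGroup E] [ContinuousSMul ℂ E] [LocallyConvexSpace ℝ E]

/-- The bipolar theorem: a non-empty closed absolutely convex set is its own bipolar. -/
theorem bipolarHull_eq_self {V : Set E} (hne : V.Nonempty) (hcl : IsClosed V)
    (hb : Balanced ℂ V) (hc : Convex ℝ V) : bipolarHull V = V := by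
  refine (subset_bipolarHull V).antisymm' fun y hy => ?_
  by_contra hyV
  obtain ⟨ℓ, u, hu, huy⟩ := RCLike.geometric_hahn_banach_closed_point (𝕜 := ℂ) hc hcl hyV
  have hbound (a : E) (ha : a ∈ V) : ‖ℓ a‖ < u := by
    by_cases h0 : ℓ a = 0
    · have := hu _ (hb.smul_mem (a := (0 : ℂ)) (by simp) ha)
      simpa [h0] using this
    -- Hahn-Banach bounds only the real part of `ℓ`; rotating `a` inside the balanced set `V` makes
    -- `ℓ a` equal to its modulus.
    · have h1 : ‖((‖ℓ a‖ : ℂ) / ℓ a)‖ ≤ 1 := by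
        rw [norm_div, Complex.norm_real, norm_norm, div_self (norm_ne_zero_iff.2 h0)]
      have := hu _ (hb.smul_mem h1 ha)
      rw [map_smul, smul_eq_mul, div_mul_cancel₀ _ h0] at this
      simpa using this
  obtain ⟨a, ha⟩ := hne
  have hu0 : 0 < u := (norm_nonneg _).trans_lt (hbound a ha)
  have h := hy ((u : ℂ)⁻¹ • ℓ) fun x hx => by
    rw [smul_apply, norm_smul, norm_inv, Complex.norm_real,
      Real.norm_of_nonneg hu0.le, inv_mul_le_iff₀ hu0, mul_one]
    exact (hbound x hx).le
  rw [smul_apply, norm_smul, norm_inv, Complex.norm_real,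
      Real.norm_of_nonneg hu0.le, inv_mul_le_iff₀ hu0, mul_one] at h
  exact absurd (huy.trans_le (Complex.re_le_norm _)) h.not_gt

theorem eq_of_forall_dual_eq [T1Space E] {x y : E} (h : ∀ ℓ : E →L[ℂ] ℂ, ℓ x = ℓ y) : x = y := by
  by_contra hxy
  obtain ⟨ℓ, hℓ⟩ := RCLike.geometric_hahn_banach_point_point (𝕜 := ℂ) hxy
  exact hℓ.ne (by rw [h ℓ])

variable (E) in
/-- In a complex locally convex space, the closed balanced convex neighbourhoods of `0` form a
neighbourhood basis of `0`. -/
theorem exists_closed_disk_nhds_subset {W : Set E} (hW : W ∈ 𝓝 (0 : E)) :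
    ∃ V ∈ 𝓝 (0 : E), IsClosed V ∧ Balanced ℂ V ∧ Convex ℝ V ∧ V ⊆ W := by
  obtain ⟨C, hC, hCcl, hCW⟩ := exists_mem_nhds_isClosed_subset hW
  obtain ⟨V, ⟨hV, hVc⟩, hVC⟩ := (LocallyConvexSpace.convex_basis_zero ℝ E).mem_iff.1 hC
  -- The balanced core need not be convex; its convex hull stays in the convex set `V` and is still
  -- balanced. The closure then stays in the closed set `C`.
  have hsub : convexHull ℝ (balancedCore ℂ V) ⊆ V :=
    convexHull_min (balancedCore_subset V) hVc
  have hbal : Balanced ℂ (convexHull ℝ (balancedCore ℂ V)) := by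
    intro a ha
    have h := ((a • LinearMap.id : E →ₗ[ℂ] E).restrictScalars ℝ).image_convexHull
      (balancedCore ℂ V)
    have h2 : ⇑((a • LinearMap.id : E →ₗ[ℂ] E).restrictScalars ℝ) = fun x => a • x := by
      ext x; simp
    rw [h2, Set.image_smul, Set.image_smul] at h
    rw [h]
    exact convexHull_mono (balancedCore_balanced V a ha)
  have : ContinuousSMul ℝ E := IsScalarTower.continuousSMul ℂ
  refine ⟨closure (convexHull ℝ (balancedCore ℂ V)), ?_, isClosed_closure, hbal.closure,
    (convex_convexHull ℝ _).closure, (closure_minimal (hsub.trans hVC) hCcl).trans hCW⟩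
  exact Filter.mem_of_superset (balancedCore_mem_nhds_zero hV)
    ((subset_convexHull ℝ _).trans subset_closure)

/-- If `S ⊆ c • V` with `V` a closed absolutely convex neighbourhood of `0`, then `c⁻¹ • ℓ` is
bounded by `1` on `S` for each `ℓ` in the polar of `V`. Hence the bipolar of `S` lies in `c` times
the bipolar of `V`, which is `V` itself. -/
theorem isVonNBounded_bipolarHull {S : Set E} (hS : Bornology.IsVonNBounded ℂ S) :
    Bornology.IsVonNBounded ℂ (bipolarHull S) := by
  intro W hW
  obtain ⟨V, hV, hVcl, hVb, hVc, hVW⟩ := exists_closed_disk_nhds_subset E hW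
  refine Absorbs.mono_left ?_ hVW
  refine absorbs_iff_norm.2 ?_
  obtain ⟨r, hr⟩ := absorbs_iff_norm.1 (hS hV)
  refine ⟨max r 1, fun c hc y hy => ?_⟩
  have hc0 : c ≠ 0 := norm_pos_iff.1 (one_pos.trans_le ((le_max_right _ _).trans hc))
  rw [Set.mem_smul_set_iff_inv_smul_mem₀ hc0,
    ← bipolarHull_eq_self ⟨0, mem_of_mem_nhds hV⟩ hVcl hVb hVc, mem_bipolarHull]
  intro ℓ hℓ
  rw [map_smul, ← smul_apply]
  refine hy _ fun x hx => ?_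
  obtain ⟨v, hv, rfl⟩ := hr c ((le_max_left _ _).trans hc) hx
  simpa [hc0] using hℓ v hv

theorem isClosedDisk_bipolarHull {S : Set E} (hne : S.Nonempty)
    (hS : Bornology.IsVonNBounded ℂ S) : IsClosedDisk (bipolarHull S) :=
  ⟨hne.mono (subset_bipolarHull S), isClosed_bipolarHull S, isVonNBounded_bipolarHull hS,
    balanced_bipolarHull S, convex_bipolarHull S⟩

end Bipolar

/-! ### Complex derivatives and factorization through Banach spaces -/

section Factorization

variable {E : Type*} [AddCommGroup E] [Module ℂ E] [TopologicalSpace E] {U : Set ℂ}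

/-- The extension of `f : U → E` by zero. -/
def zeroExtend (f : U → E) : ℂ → E := Function.extend Subtype.val f 0

omit [Module ℂ E] [TopologicalSpace E] in
@[simp]
theorem zeroExtend_coe (f : U → E) (z : U) : zeroExtend f z = f z :=
  Subtype.val_injective.extend_apply f 0 z

/-- Since `U` is open, limits of difference quotients within `U` and in `ℂ` agree; this links
`HasComplexDerivAt` to `HasDerivAt`. -/
theorem map_val_nhdsNE (hU : IsOpen U) (z : U) :
    map Subtype.val (𝓝[≠] z) = 𝓝[≠] (z : ℂ) := by
  rw [← hU.isOpenEmbedding_subtypeVal.map_nhdsWithin_preimage_eq]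
  congr 2
  ext w
  simp [Subtype.ext_iff]

theorem nhdsNE_neBot (hU : IsOpen U) (z : U) : (𝓝[≠] z).NeBot := by
  rw [← map_neBot_iff Subtype.val, map_val_nhdsNE hU]
  infer_instance

theorem HasComplexDerivAt.complexDeriv_eq [T2Space E] (hU : IsOpen U) {f : U → E} {d : E} {z : U}
    (h : HasComplexDerivAt f d z) : complexDeriv f z = d := by
  have := nhdsNE_neBot hU z
  exact h.limUnder_eq

theorem HasComplexDerivAt.hasDerivAt_dual (hU : IsOpen U) {f : U → E} {d : E} {z : U}
    (h : HasComplexDerivAt f d z) (ℓ : E →L[ℂ] ℂ) :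
    HasDerivAt (fun w => ℓ (zeroExtend f w)) (ℓ d) z := by
  rw [hasDerivAt_iff_tendsto_slope, ← map_val_nhdsNE hU, tendsto_map'_iff]
  refine ((ℓ.continuous.tendsto d).comp h).congr fun w => ?_
  simp [slope]

theorem IsHolomorphic.differentiableOn_dual (hU : IsOpen U) {f : U → E} (hf : IsHolomorphic f)
    (ℓ : E →L[ℂ] ℂ) : DifferentiableOn ℂ (fun w => ℓ (zeroExtend f w)) U := by
  intro z hz
  obtain ⟨d, hd⟩ := hf ⟨z, hz⟩
  exact (hd.hasDerivAt_dual hU ℓ).differentiableAt.differentiableWithinAt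

theorem HasDerivAt.hasComplexDerivAt_of_eventuallyEq {F : Type*} [NormedAddCommGroup F]
    [NormedSpace ℂ F] (hU : IsOpen U) (ι : F →L[ℂ] E) {f : U → E} {g : ℂ → F} {d : F} {z : U}
    (h : HasDerivAt g d z) (hfg : ∀ᶠ w in 𝓝 z, f w = ι (g (w : ℂ))) :
    HasComplexDerivAt f (ι d) z := by
  rw [hasDerivAt_iff_tendsto_slope, ← map_val_nhdsNE hU, tendsto_map'_iff] at h
  refine ((ι.continuous.tendsto d).comp h).congr' ?_
  filter_upwards [hfg.filter_mono nhdsWithin_le_nhds] with w hw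
  simp [slope, hw, hfg.self_of_nhds]

/-- If `f` factors through a Banach space on a ball via a holomorphic function, then so do its
derivatives. -/
theorem iteratedComplexDeriv_eq_of_factorization {F : Type*} [NormedAddCommGroup F]
    [NormedSpace ℂ F] [CompleteSpace F] [T2Space E] (hU : IsOpen U) (ι : F →L[ℂ] E)
    {f : U → E} {g : ℂ → F} {V : Set ℂ} (hV : IsOpen V) (hg : DifferentiableOn ℂ g V)
    (hfg : ∀ w : U, (w : ℂ) ∈ V → f w = ι (g w)) (n : ℕ) :
    ∀ w : U, (w : ℂ) ∈ V → iteratedComplexDeriv n f w = ι (iteratedDeriv n g w) ∧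
      HasComplexDerivAt (iteratedComplexDeriv n f) (ι (iteratedDeriv (n + 1) g w)) w := by
  have hderiv (n : ℕ) (w : U) (hw : (w : ℂ) ∈ V) :
      HasDerivAt (iteratedDeriv n g) (iteratedDeriv (n + 1) g w) (w : ℂ) := by
    rw [iteratedDeriv_succ]
    refine DifferentiableAt.hasDerivAt ?_
    have h := (hg.analyticOnNhd hV).iterated_deriv n w hw
    rw [← iteratedDeriv_eq_iterate] at h
    exact h.differentiableAt
  have hev (n : ℕ) (h : ∀ w : U, (w : ℂ) ∈ V → iteratedComplexDeriv n f w = ι (iteratedDeriv n g w))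
      (w : U) (hw : (w : ℂ) ∈ V) :
      HasComplexDerivAt (iteratedComplexDeriv n f) (ι (iteratedDeriv (n + 1) g w)) w := by
    refine (hderiv n w hw).hasComplexDerivAt_of_eventuallyEq hU ι ?_
    filter_upwards [continuous_subtype_val.continuousAt.preimage_mem_nhds (hV.mem_nhds hw)] with v hv
      using h v hv
  have heq : ∀ w : U, (w : ℂ) ∈ V → iteratedComplexDeriv n f w = ι (iteratedDeriv n g w) := by
    induction n with
    | zero => simpa [iteratedComplexDeriv] using hfg
    | succ n ih => exact fun w hw => (hev n ih w hw).complexDeriv_eq hU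
  exact fun w hw => ⟨heq w hw, hev n heq w hw⟩

/-- A holomorphic function bounded by `1` on a closed disk is Lipschitz on smaller disks. -/
theorem norm_sub_le_of_norm_le_one {h : ℂ → ℂ} {c : ℂ} {ρ R : ℝ} (hρR : ρ < R)
    (hU : IsOpen U) (hh : DifferentiableOn ℂ h U) (hK : Metric.closedBall c R ⊆ U)
    (h1 : ∀ z ∈ Metric.closedBall c R, ‖h z‖ ≤ 1) {x y : ℂ} (hx : x ∈ Metric.closedBall c ρ)
    (hy : y ∈ Metric.closedBall c ρ) : ‖h y - h x‖ ≤ 1 / (R - ρ) * ‖y - x‖ := by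
  refine (convex_closedBall c ρ).norm_image_sub_le_of_norm_deriv_le (𝕜 := ℂ) (fun z hz => ?_)
    (fun z hz => ?_) hx hy
  · exact hh.differentiableAt (hU.mem_nhds (hK (Metric.closedBall_subset_closedBall hρR.le hz)))
  -- Around each point of the smaller disk there is room for radius `R - ρ`, so Cauchy's estimate
  -- bounds the derivative by `1 / (R - ρ)`.
  · have hsub : Metric.closedBall z (R - ρ) ⊆ Metric.closedBall c R := by
      refine Metric.closedBall_subset_closedBall' ?_
      have := Metric.mem_closedBall.1 hz
      linarith
    refine Complex.norm_deriv_le_of_forall_mem_sphere_norm_le (sub_pos.2 hρR) ?_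
      fun w hw => h1 w (hsub (Metric.sphere_subset_closedBall hw))
    exact (hh.mono ((Metric.closure_ball_subset_closedBall.trans hsub).trans hK)).diffContOnCl

/-- The Cauchy integral formula, transported along a continuous linear functional. -/
theorem dual_cauchy_integral {F : Type*} [NormedAddCommGroup F] [NormedSpace ℂ F] [CompleteSpace F]
    (L : F →L[ℂ] ℂ) {g : ℂ → F} {h : ℂ → ℂ} {c w : ℂ} {ρ : ℝ}
    (hg : ContinuousOn g (Metric.closedBall c ρ)) (hh : DifferentiableOn ℂ h (Metric.closedBall c ρ))
    (hgh : ∀ z ∈ Metric.closedBall c ρ, L (g z) = h z) (hw : w ∈ Metric.ball c ρ) :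
    L ((2 * Real.pi * Complex.I : ℂ)⁻¹ • ∮ z in C(c, ρ), (z - w)⁻¹ • g z) = h w := by
  have hρ : 0 < ρ := Metric.pos_of_mem_ball hw
  have hne : ∀ z ∈ Metric.sphere c ρ, z - w ≠ 0 := by
    intro z hz h0
    rw [sub_eq_zero.1 h0, Metric.mem_sphere] at hz
    exact (Metric.mem_ball.1 hw).ne hz
  have hint : CircleIntegrable (fun z => (z - w)⁻¹ • g z) c ρ :=
    ContinuousOn.circleIntegrable hρ.le
      (((continuousOn_id.sub continuousOn_const).inv₀ hne).smul
        (hg.mono Metric.sphere_subset_closedBall))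
  have hcomm : L (∮ z in C(c, ρ), (z - w)⁻¹ • g z) = ∮ z in C(c, ρ), (z - w)⁻¹ • h z := by
    have h1 : (∮ z in C(c, ρ), (z - w)⁻¹ • h z) = ∮ z in C(c, ρ), L ((z - w)⁻¹ • g z) :=
      circleIntegral.integral_congr hρ.le fun z hz => by
        rw [map_smul, hgh z (Metric.sphere_subset_closedBall hz)]
    rw [h1]
    simp only [circleIntegral]
    rw [← L.intervalIntegral_comp_comm hint.out]
    simp only [map_smul]
  rw [map_smul, hcomm, hh.circleIntegral_sub_inv_smul hw, smul_smul, inv_mul_cancel₀, one_smul]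
  exact Complex.two_pi_I_ne_zero

end Factorization

universe u in
/-- A holomorphic function with values in a locally complete space factors locally through a
Banach space, via a holomorphic function. -/
theorem IsHolomorphic.exists_factorization {E : Type u} [AddCommGroup E] [Module ℂ E]
    [TopologicalSpace E] [IsTopologicalAddGroup E] [ContinuousSMul ℂ E] [LocallyConvexSpace ℝ E]
    [T2Space E] (hE : IsLocallyComplete E) {U : Set ℂ} (hU : IsOpen U) {f : U → E}
    (hf : IsHolomorphic f) {c : ℂ} {ρ R : ℝ} (hρ : 0 < ρ) (hρR : ρ < R)
    (hK : Metric.closedBall c R ⊆ U) :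
    ∃ (F : Type u) (_ : NormedAddCommGroup F) (_ : NormedSpace ℂ F) (_ : CompleteSpace F)
      (ι : F →L[ℂ] E) (g : ℂ → F), DifferentiableOn ℂ g (Metric.ball c ρ) ∧
        ∀ w : U, (w : ℂ) ∈ Metric.ball c ρ → f w = ι (g w) := by
  set S : Set E := f '' (Subtype.val ⁻¹' Metric.closedBall c R) with hS
  have hScomp : IsCompact S := by
    refine IsCompact.image ?_ hf.continuous
    rw [Subtype.isCompact_iff, Subtype.image_preimage_coe, Set.inter_eq_right.2 hK]
    exact isCompact_closedBall c R
  have hcK : c ∈ Metric.closedBall c R := Metric.mem_closedBall_self (hρ.trans hρR).le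
  have hD : IsClosedDisk (bipolarHull S) :=
    isClosedDisk_bipolarHull ⟨f ⟨c, hK hcK⟩, ⟨c, hK hcK⟩, hcK, rfl⟩
      (hScomp.isVonNBounded ℂ)
  have hmemS : ∀ z ∈ Metric.closedBall c R, zeroExtend f z ∈ S := fun z hz =>
    ⟨⟨z, hK hz⟩, hz, (zeroExtend_coe f ⟨z, hK hz⟩).symm⟩
  obtain ⟨F, _, _, _, ι, hinj, hι⟩ := hD.exists_banach hE
  have hex (z : ℂ) : ∃ y, z ∈ Metric.closedBall c R → ι y = zeroExtend f z := by
    by_cases hz : z ∈ Metric.closedBall c R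
    · obtain ⟨y, -, hy⟩ := hι 1 zero_le_one (zeroExtend f z)
        (by rw [one_smul]; exact subset_bipolarHull S (hmemS z hz))
      exact ⟨y, fun _ => hy⟩
    · exact ⟨0, fun h => absurd h hz⟩
  choose g hg using hex
  have hsub : Metric.closedBall c ρ ⊆ Metric.closedBall c R :=
    Metric.closedBall_subset_closedBall hρR.le
  have hlip : ∀ x ∈ Metric.closedBall c ρ, ∀ y ∈ Metric.closedBall c ρ,
      ‖g y - g x‖ ≤ 1 / (R - ρ) * ‖y - x‖ := by
    intro x hx y hy
    -- `mem_smul_bipolarHull` needs a positive multiple, so coinciding points are set apart.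
    rcases eq_or_ne y x with rfl | hxy
    · simp
    have ht : 0 < 1 / (R - ρ) * ‖y - x‖ :=
      mul_pos (one_div_pos.2 (sub_pos.2 hρR)) (norm_pos_iff.2 (sub_ne_zero.2 hxy))
    obtain ⟨v, hv, hιv⟩ := hι _ ht.le (zeroExtend f y - zeroExtend f x)
      (mem_smul_bipolarHull ht fun ℓ hℓ => by
        rw [map_sub]
        exact norm_sub_le_of_norm_le_one hρR hU (hf.differentiableOn_dual hU ℓ) hK
          (fun z hz => hℓ _ (hmemS z hz)) hx hy)
    rw [← hg y (hsub hy), ← hg x (hsub hx), ← map_sub] at hιv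
    rwa [← hinj hιv]
  have hcont : ContinuousOn g (Metric.closedBall c ρ) :=
    (LipschitzOnWith.of_dist_le_mul (K := (1 / (R - ρ)).toNNReal) fun y hy x hx => by
      rw [dist_eq_norm, dist_eq_norm,
        Real.coe_toNNReal _ (one_div_pos.2 (sub_pos.2 hρR)).le]
      exact hlip x hx y hy).continuousOn
  -- Only continuity of `g` is known, so the holomorphic factor is its Cauchy integral.
  lift ρ to NNReal using hρ.le
  refine ⟨F, inferInstance, inferInstance, inferInstance, ι,
    fun w => (2 * Real.pi * Complex.I : ℂ)⁻¹ • ∮ z in C(c, ρ), (z - w)⁻¹ • g z, ?_, fun w hw => ?_⟩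
  · have h := (hasFPowerSeriesOn_cauchy_integral (f := g) (c := c) (R := ρ)
      (ContinuousOn.circleIntegrable hρ.le (hcont.mono Metric.sphere_subset_closedBall))
      (by exact_mod_cast hρ)).differentiableOn
    rwa [Metric.eball_coe] at h
  · refine eq_of_forall_dual_eq fun ℓ => ?_
    rw [← zeroExtend_coe f w]
    refine (dual_cauchy_integral (ℓ.comp ι) hcont
      ((hf.differentiableOn_dual hU ℓ).mono (hsub.trans hK)) (fun z hz => ?_) hw).symm
    rw [ContinuousLinearMap.comp_apply, hg z (hsub hz)]

/-! ### Higher derivatives -/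

section HigherDerivatives

variable {E : Type*} [AddCommGroup E] [Module ℂ E] [TopologicalSpace E]
  [IsTopologicalAddGroup E] [ContinuousSMul ℂ E] [LocallyConvexSpace ℝ E] [T2Space E] {U : Set ℂ}

theorem IsHolomorphic.iteratedComplexDeriv (hE : IsLocallyComplete E) (hU : IsOpen U) {f : U → E}
    (hf : IsHolomorphic f) (n : ℕ) : IsHolomorphic (iteratedComplexDeriv n f) := by
  intro z
  obtain ⟨R, hR, hRU⟩ := Metric.nhds_basis_closedBall.mem_iff.1 (hU.mem_nhds z.2)
  obtain ⟨F, _, _, _, ι, g, hg, hfg⟩ :=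
    hf.exists_factorization hE hU (half_pos hR) (half_lt_self hR) hRU
  exact ⟨_, (iteratedComplexDeriv_eq_of_factorization hU ι Metric.isOpen_ball hg hfg n z
    (Metric.mem_ball_self (half_pos hR))).2⟩

omit [LocallyConvexSpace ℝ E] [IsTopologicalAddGroup E] [ContinuousSMul ℂ E] in
theorem IsHolomorphic.hasComplexDerivAt (hU : IsOpen U) {f : U → E} (hf : IsHolomorphic f) (z : U) :
    HasComplexDerivAt f (complexDeriv f z) z := by
  obtain ⟨d, hd⟩ := hf z
  rwa [hd.complexDeriv_eq hU]

theorem iteratedComplexDeriv_add (hE : IsLocallyComplete E) (hU : IsOpen U) {f g : U → E}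
    (hf : IsHolomorphic f) (hg : IsHolomorphic g) (n : ℕ) :
    iteratedComplexDeriv n (f + g) = iteratedComplexDeriv n f + iteratedComplexDeriv n g := by
  induction n with
  | zero => rfl
  | succ n ih =>
    funext z
    simp only [iteratedComplexDeriv, ih, Pi.add_apply]
    refine HasComplexDerivAt.complexDeriv_eq hU ?_
    refine (((hf.iteratedComplexDeriv hE hU n).hasComplexDerivAt hU z).add
      ((hg.iteratedComplexDeriv hE hU n).hasComplexDerivAt hU z)).congr fun w => ?_
    rw [← smul_add, Pi.add_apply, Pi.add_apply, add_sub_add_comm]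

theorem iteratedComplexDeriv_const_smul (hE : IsLocallyComplete E) (hU : IsOpen U) (c : ℂ)
    {f : U → E} (hf : IsHolomorphic f) (n : ℕ) :
    iteratedComplexDeriv n (c • f) = c • iteratedComplexDeriv n f := by
  induction n with
  | zero => rfl
  | succ n ih =>
    funext z
    simp only [iteratedComplexDeriv, ih, Pi.smul_apply]
    refine HasComplexDerivAt.complexDeriv_eq hU ?_
    refine (((hf.iteratedComplexDeriv hE hU n).hasComplexDerivAt hU z).const_smul c).congr
      fun w => ?_
    rw [Pi.smul_apply, Pi.smul_apply, ← smul_sub, smul_comm]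

theorem dual_iteratedComplexDeriv (hE : IsLocallyComplete E) (hU : IsOpen U) {f : U → E}
    (hf : IsHolomorphic f) (ℓ : E →L[ℂ] ℂ) (n : ℕ) (z : U) :
    ℓ (iteratedComplexDeriv n f z) = iteratedDeriv n (fun w => ℓ (zeroExtend f w)) z := by
  induction n generalizing z with
  | zero => simp [iteratedComplexDeriv]
  | succ n ih =>
    have h := ((hf.iteratedComplexDeriv hE hU n).hasComplexDerivAt hU z).hasDerivAt_dual hU ℓ
    rw [iteratedDeriv_succ, iteratedComplexDeriv, ← h.deriv]
    refine EventuallyEq.deriv_eq ?_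
    filter_upwards [hU.mem_nhds z.2] with w hw
    rw [← ih ⟨w, hw⟩, ← zeroExtend_coe (_root_.iteratedComplexDeriv n f)]

/-- Cauchy estimate. -/
theorem norm_dual_iteratedComplexDeriv_le (hE : IsLocallyComplete E) (hU : IsOpen U) {f : U → E}
    (hf : IsHolomorphic f) (ℓ : E →L[ℂ] ℂ) (n : ℕ) (z : U) {ρ C : ℝ} (hρ : 0 < ρ)
    (hK : Metric.closedBall (z : ℂ) ρ ⊆ U)
    (hC : ∀ w : U, (w : ℂ) ∈ Metric.closedBall (z : ℂ) ρ → ‖ℓ (f w)‖ ≤ C) :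
    ‖ℓ (iteratedComplexDeriv n f z)‖ ≤ n ! * C / ρ ^ n := by
  rw [dual_iteratedComplexDeriv hE hU hf]
  refine Complex.norm_iteratedDeriv_le_of_forall_mem_sphere_norm_le n hρ ?_ fun w hw => ?_
  · exact ((hf.differentiableOn_dual hU ℓ).mono
      (Metric.closure_ball_subset_closedBall.trans hK)).diffContOnCl
  · have hw' := Metric.sphere_subset_closedBall hw
    have := hC ⟨w, hK hw'⟩ hw'
    rwa [← zeroExtend_coe f] at this

-- The monomial factors through `ℂ` via the line spanned by `e`, so the scalar formula suffices and
-- no completeness of `E` enters.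
omit [IsTopologicalAddGroup E] [LocallyConvexSpace ℝ E] in
theorem iteratedComplexDeriv_monomial (hU : IsOpen U) (a : U) (m n : ℕ) (e : E) :
    iteratedComplexDeriv n (fun z : U => ((z : ℂ) - a) ^ m • e) a =
      if n = m then (n ! : ℂ) • e else 0 := by
  have h := (iteratedComplexDeriv_eq_of_factorization hU (ContinuousLinearMap.toSpanSingleton ℂ e)
    (f := fun z : U => ((z : ℂ) - a) ^ m • e) (g := fun w => (w - a) ^ m) (V := Set.univ)
    isOpen_univ (by fun_prop) (fun w _ => by simp) n a trivial).1
  rw [h, iteratedDeriv_comp_sub_const n (fun w : ℂ => w ^ m)]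
  simp only [iteratedDeriv_pow, sub_self, ContinuousLinearMap.toSpanSingleton_apply]
  split_ifs with hnm
  · subst hnm
    simp [Nat.descFactorial_self]
  · rcases lt_or_gt_of_ne hnm with hlt | hlt
    · simp [zero_pow (Nat.sub_ne_zero_of_lt hlt)]
    · simp [Nat.descFactorial_of_lt hlt]

end HigherDerivatives

/-! ### The terms of the power series -/

section PowerSeries

variable {E : Type*} [AddCommGroup E] [Module ℂ E] [TopologicalSpace E]
  [IsTopologicalAddGroup E] [ContinuousSMul ℂ E] [LocallyConvexSpace ℝ E] [T2Space E] {U : Set ℂ}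

/-- The `n`-th derivative at a point, as a linear map on the space of holomorphic functions. -/
def iteratedComplexDerivLinearMap (hE : IsLocallyComplete E) (hU : IsOpen U) (z₀ : U) (n : ℕ) :
    HolomorphicFunctions U E →ₗ[ℂ] E where
  toFun f := iteratedComplexDeriv n f.1 z₀
  map_add' f g := congr_fun (iteratedComplexDeriv_add hE hU f.2 g.2 n) z₀
  map_smul' c f := congr_fun (iteratedComplexDeriv_const_smul hE hU c f.2 n) z₀

/-- If `f` maps the closed disk of radius `ρ` into `(ρ ^ n / n !) • V`, Cauchy's estimate gives `‖ℓ
(∂ⁿ f z₀)‖ ≤ 1` for all `ℓ` in the polar of `V`, so `∂ⁿ f z₀` lies in the bipolar of `V`, which is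
`V`. -/
theorem continuous_iteratedComplexDerivLinearMap (hE : IsLocallyComplete E) (hU : IsOpen U)
    (z₀ : U) (n : ℕ) : Continuous (iteratedComplexDerivLinearMap hE hU z₀ n) := by
  refine continuous_of_continuousAt_zero (iteratedComplexDerivLinearMap hE hU z₀ n) ?_
  rw [ContinuousAt, map_zero]
  intro W hW
  obtain ⟨V, hV, hVcl, hVb, hVc, hVW⟩ := exists_closed_disk_nhds_subset E hW
  obtain ⟨ρ, hρ, hρU⟩ := Metric.nhds_basis_closedBall.mem_iff.1 (hU.mem_nhds z₀.2)
  have hc : ((ρ ^ n / n ! : ℝ) : ℂ) ≠ 0 := by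
    exact_mod_cast (by positivity : (0 : ℝ) < ρ ^ n / n !).ne'
  have hK : IsCompact (Subtype.val ⁻¹' Metric.closedBall (z₀ : ℂ) ρ : Set U) := by
    rw [Subtype.isCompact_iff, Subtype.image_preimage_coe, Set.inter_eq_right.2 hρU]
    exact isCompact_closedBall _ _
  have h0 : (0 : E) ∈ interior (((ρ ^ n / n ! : ℝ) : ℂ) • V) :=
    mem_interior_iff_mem_nhds.2 ((set_smul_mem_nhds_zero_iff hc).2 hV)
  have hev := ContinuousMap.eventually_mapsTo (f := (0 : C(U, E))) hK isOpen_interior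
    fun _ _ => h0
  have hev' := (continuous_subtype_val (p := (· ∈ HolomorphicFunctions U E))).tendsto 0 hev
  rw [Filter.mem_map] at hev' ⊢
  filter_upwards [hev'] with f hf
  refine hVW ?_
  rw [← bipolarHull_eq_self ⟨0, mem_of_mem_nhds hV⟩ hVcl hVb hVc, mem_bipolarHull]
  intro ℓ hℓ
  refine (norm_dual_iteratedComplexDeriv_le hE hU f.2 ℓ n z₀ hρ hρU
    (C := ρ ^ n / n !) fun w hw => ?_).trans (le_of_eq (by field_simp))
  obtain ⟨v, hv, hvw⟩ := interior_subset (hf hw)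
  have hvw' : f.1 w = ((ρ ^ n / n ! : ℝ) : ℂ) • v := hvw.symm
  rw [hvw', map_smul, norm_smul, Complex.norm_real, Real.norm_of_nonneg (by positivity)]
  exact mul_le_of_le_one_right (by positivity) (hℓ v hv)

omit [LocallyConvexSpace ℝ E] [T2Space E] in
theorem powerSeriesTerm_apply (z₀ : U) (n : ℕ) (f : HolomorphicFunctions U E) (z : U) :
    (powerSeriesTerm z₀ n f).1 z =
      ((z : ℂ) - z₀) ^ n • ((n ! : ℂ)⁻¹ • iteratedComplexDeriv n f.1 z₀) := rfl

/-- The `n`-th term of the power series, as a linear map. -/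
def powerSeriesTermLinearMap (hE : IsLocallyComplete E) (hU : IsOpen U) (z₀ : U) (n : ℕ) :
    HolomorphicFunctions U E →ₗ[ℂ] HolomorphicFunctions U E where
  toFun := powerSeriesTerm z₀ n
  map_add' f g := by
    ext z
    change _ = (powerSeriesTerm z₀ n f).1 z + (powerSeriesTerm z₀ n g).1 z
    simp only [powerSeriesTerm_apply, ← smul_add]
    exact congr_arg _ (congr_arg _ ((iteratedComplexDerivLinearMap hE hU z₀ n).map_add f g))
  map_smul' c f := by
    ext z
    change _ = c • (powerSeriesTerm z₀ n f).1 z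
    simp only [powerSeriesTerm_apply]
    rw [smul_comm c, smul_comm c]
    exact congr_arg _ (congr_arg _ ((iteratedComplexDerivLinearMap hE hU z₀ n).map_smul c f))

theorem powerSeriesTermLinearMap_apply (hE : IsLocallyComplete E) (hU : IsOpen U) (z₀ : U) (n : ℕ)
    (f : HolomorphicFunctions U E) :
    powerSeriesTermLinearMap hE hU z₀ n f = powerSeriesTerm z₀ n f := rfl

theorem continuous_powerSeriesTerm (hE : IsLocallyComplete E) (hU : IsOpen U) (z₀ : U) (n : ℕ) :
    Continuous (powerSeriesTerm z₀ n : HolomorphicFunctions U E → HolomorphicFunctions U E) := by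
  refine Continuous.subtype_mk (ContinuousMap.continuous_of_continuous_uncurry _ ?_) _
  have h := (continuous_iteratedComplexDerivLinearMap hE hU z₀ n).comp
    (continuous_fst (X := HolomorphicFunctions U E) (Y := U))
  have h2 : Continuous fun p : HolomorphicFunctions U E × U => ((p.2 : ℂ) - z₀) ^ n := by fun_prop
  exact h2.smul (h.const_smul ((n ! : ℂ)⁻¹))

omit [LocallyConvexSpace ℝ E] in
theorem powerSeriesTerm_powerSeriesTerm (hU : IsOpen U) (z₀ : U) (n m : ℕ)
    (f : HolomorphicFunctions U E) :
    powerSeriesTerm z₀ n (powerSeriesTerm z₀ m f) = if n = m then powerSeriesTerm z₀ n f else 0 := by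
  ext z
  rw [powerSeriesTerm_apply]
  have h : iteratedComplexDeriv n (powerSeriesTerm z₀ m f).1 z₀ = _ :=
    iteratedComplexDeriv_monomial hU z₀ m n ((m ! : ℂ)⁻¹ • iteratedComplexDeriv m f.1 z₀)
  rw [h]
  split_ifs with hnm
  · subst hnm
    rw [inv_smul_smul₀ (by exact_mod_cast n.factorial_ne_zero), powerSeriesTerm_apply]
  · simp

/-- The partial sums of the power series, as linear maps. -/
def powerSeriesPartialSumLinearMap (hE : IsLocallyComplete E) (hU : IsOpen U) (z₀ : U) (k : ℕ) :
    HolomorphicFunctions U E →ₗ[ℂ] HolomorphicFunctions U E :=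
  ∑ n ∈ Finset.range (k + 1), powerSeriesTermLinearMap hE hU z₀ n

theorem powerSeriesPartialSumLinearMap_apply (hE : IsLocallyComplete E) (hU : IsOpen U) (z₀ : U)
    (k : ℕ) (f : HolomorphicFunctions U E) :
    powerSeriesPartialSumLinearMap hE hU z₀ k f = powerSeriesPartialSum z₀ k f := by
  simp [powerSeriesPartialSumLinearMap, powerSeriesPartialSum, powerSeriesTermLinearMap_apply]

omit [LocallyConvexSpace ℝ E] in
theorem powerSeriesPartialSum_powerSeriesTerm (hU : IsOpen U) (z₀ : U) (k m : ℕ)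
    (f : HolomorphicFunctions U E) : powerSeriesPartialSum z₀ k (powerSeriesTerm z₀ m f) =
      if m ≤ k then powerSeriesTerm z₀ m f else 0 := by
  simp only [powerSeriesPartialSum, powerSeriesTerm_powerSeriesTerm hU, Finset.sum_ite_eq',
    Finset.mem_range, Nat.lt_succ_iff]

theorem powerSeriesPartialSum_powerSeriesPartialSum (hE : IsLocallyComplete E) (hU : IsOpen U)
    (z₀ : U) (k j : ℕ) (f : HolomorphicFunctions U E) :
    powerSeriesPartialSum z₀ k (powerSeriesPartialSum z₀ j f) =
      powerSeriesPartialSum z₀ (min j k) f := by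
  rw [← powerSeriesPartialSumLinearMap_apply hE hU z₀ k, powerSeriesPartialSum, map_sum]
  simp only [powerSeriesPartialSumLinearMap_apply, powerSeriesPartialSum_powerSeriesTerm hU]
  rw [powerSeriesPartialSum, ← Finset.sum_filter]
  congr 1
  ext n
  simp only [Finset.mem_filter, Finset.mem_range]
  omega

omit [LocallyConvexSpace ℝ E] in
theorem powerSeriesPartialSum_ne_of_lt [Nontrivial E] (hU : IsOpen U) (z₀ : U) {k j : ℕ}
    (hjk : j < k) : (powerSeriesPartialSum z₀ k :
      HolomorphicFunctions U E → HolomorphicFunctions U E) ≠ powerSeriesPartialSum z₀ j := by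
  intro h
  obtain ⟨e, he⟩ := exists_ne (0 : E)
  -- A non-zero monomial of degree `k`: the `k`-th partial sum fixes it and the `j`-th kills it.
  let f : HolomorphicFunctions U E :=
    ⟨⟨fun z => ((z : ℂ) - z₀) ^ k • e, (isHolomorphic_monomial _ k _).continuous⟩,
      isHolomorphic_monomial _ k _⟩
  have hf : iteratedComplexDeriv k f.1 z₀ = (k ! : ℂ) • e :=
    (iteratedComplexDeriv_monomial hU z₀ k k e).trans (if_pos rfl)
  have hterm : powerSeriesTerm z₀ k f = f := by
    ext z
    rw [powerSeriesTerm_apply, hf, inv_smul_smul₀ (by exact_mod_cast k.factorial_ne_zero)]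
    rfl
  have h1 := congr_fun h (powerSeriesTerm z₀ k f)
  rw [powerSeriesPartialSum_powerSeriesTerm hU, powerSeriesPartialSum_powerSeriesTerm hU,
    if_pos le_rfl, if_neg hjk.not_ge, hterm] at h1
  have hzero : iteratedComplexDeriv k (0 : HolomorphicFunctions U E).1 z₀ = 0 := by
    have h2 := iteratedComplexDeriv_monomial hU z₀ k k (0 : E)
    simp only [smul_zero, ite_self] at h2
    exact h2
  rw [h1, hzero] at hf
  exact smul_ne_zero (by exact_mod_cast k.factorial_ne_zero) he hf.symm

omit [LocallyConvexSpace ℝ E] [T2Space E] in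
theorem powerSeriesPartialSum_apply (z₀ : U) (k : ℕ) (f : HolomorphicFunctions U E) (z : U) :
    (powerSeriesPartialSum z₀ k f).1 z = ∑ n ∈ Finset.range (k + 1),
      ((z : ℂ) - z₀) ^ n • ((n ! : ℂ)⁻¹ • iteratedComplexDeriv n f.1 z₀) := by
  simp [powerSeriesPartialSum, powerSeriesTerm_apply, ContinuousMap.sum_apply]

end PowerSeries

/-! ### Convergence of the power series -/

/-- The Taylor series of a Banach-valued holomorphic function on a disk converges uniformly on
smaller concentric disks. -/
theorem tendstoUniformlyOn_taylorSeries {F : Type*} [NormedAddCommGroup F] [NormedSpace ℂ F]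
    [CompleteSpace F] {g : ℂ → F} {c : ℂ} {a ρ : ℝ} (ha : 0 < a) (haρ : a < ρ)
    (hg : DifferentiableOn ℂ g (Metric.ball c ρ)) :
    TendstoUniformlyOn
      (fun (N : ℕ) w => ∑ n ∈ Finset.range N, (w - c) ^ n • ((n ! : ℂ)⁻¹ • iteratedDeriv n g c))
      g atTop (Metric.closedBall c a) := by
  -- Cauchy's estimate on the sphere of radius `b` bounds the terms by `C * (a / b) ^ n` on the disk
  -- of radius `a`, and the Weierstrass test applies.
  obtain ⟨b, hab, hbρ⟩ := exists_between haρ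
  have hb : 0 < b := ha.trans hab
  have hsub : Metric.closedBall c b ⊆ Metric.ball c ρ := Metric.closedBall_subset_ball hbρ
  obtain ⟨C, hC⟩ := (isCompact_sphere c b).exists_bound_of_continuousOn
    (hg.continuousOn.mono (Metric.sphere_subset_closedBall.trans hsub))
  have hbound (n : ℕ) (w : ℂ) (hw : w ∈ Metric.closedBall c a) :
      ‖(w - c) ^ n • ((n ! : ℂ)⁻¹ • iteratedDeriv n g c)‖ ≤ C * (a / b) ^ n := by
    have h1 := Complex.norm_iteratedDeriv_le_of_forall_mem_sphere_norm_le n hb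
      (hg.mono (Metric.closure_ball_subset_closedBall.trans hsub)).diffContOnCl hC
    rw [norm_smul, norm_smul, norm_pow, norm_inv, Complex.norm_natCast]
    have h2 : ‖w - c‖ ≤ a := by simpa [dist_eq_norm] using hw
    calc ‖w - c‖ ^ n * ((n ! : ℝ)⁻¹ * ‖iteratedDeriv n g c‖)
        ≤ a ^ n * ((n ! : ℝ)⁻¹ * (n ! * C / b ^ n)) := by gcongr
      _ = C * (a / b) ^ n := by
        have : (n ! : ℝ) ≠ 0 := by exact_mod_cast n.factorial_ne_zero
        rw [div_pow]
        field_simp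
  have hsum : Summable fun n : ℕ => C * (a / b) ^ n :=
    (summable_geometric_of_lt_one (by positivity) ((div_lt_one hb).2 hab)).mul_left C
  refine (tendstoUniformlyOn_tsum_nat hsum hbound).congr_right fun w hw => ?_
  have h := Complex.hasSum_taylorSeries_on_ball hg (Metric.closedBall_subset_ball haρ hw)
  simp only [smul_comm ((_ : ℂ)⁻¹) (_ ^ _ : ℂ)] at h
  exact h.tsum_eq

/-- A compact subset of an open disk, possibly of infinite radius, is contained in a smaller one. -/
theorem exists_closedBall_of_isCompact_subset_eball {z₀ : ℂ} {r : ℝ≥0∞} (hr : 0 < r) {K : Set ℂ}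
    (hK : IsCompact K) (hKr : K ⊆ Metric.eball z₀ r) :
    ∃ a R : ℝ, 0 < a ∧ a < R ∧ K ⊆ Metric.closedBall z₀ a ∧
      Metric.closedBall z₀ R ⊆ Metric.eball z₀ r := by
  -- The distance to `z₀` attains its maximum on `K`, so the bound is strictly below `r`, even for
  -- `r = ∞`.
  obtain ⟨m, hm, hKm⟩ : ∃ m < r, ∀ x ∈ K, edist x z₀ ≤ m := by
    rcases K.eq_empty_or_nonempty with rfl | hne
    · exact ⟨0, hr, by simp⟩
    · obtain ⟨x, hx, hmax⟩ := hK.exists_isMaxOn hne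
        (f := fun x => edist x z₀) (by fun_prop)
      exact ⟨_, hKr hx, fun y hy => hmax hy⟩
  obtain ⟨a, hma, har⟩ := ENNReal.lt_iff_exists_nnreal_btwn.1 hm
  obtain ⟨R, haR, hRr⟩ := ENNReal.lt_iff_exists_nnreal_btwn.1 har
  refine ⟨a, R, ?_, by exact_mod_cast haR, fun x hx => ?_, fun x hx => ?_⟩
  · have : (0 : ℝ≥0∞) < a := zero_le.trans_lt hma
    exact_mod_cast this
  · rw [← Metric.closedEBall_coe]
    exact (hKm x hx).trans hma.le
  · rw [← Metric.closedEBall_coe] at hx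
    exact (Metric.mem_closedEBall.1 hx).trans_lt hRr

theorem tendsto_powerSeriesPartialSum {E : Type*} [AddCommGroup E] [Module ℂ E]
    [TopologicalSpace E] [IsTopologicalAddGroup E] [ContinuousSMul ℂ E] [LocallyConvexSpace ℝ E]
    [T2Space E] (hE : IsLocallyComplete E) (z₀ : ℂ) {r : ℝ≥0∞} (hr : 0 < r)
    (f : HolomorphicFunctions (Metric.eball z₀ r) E) :
    Tendsto (fun k => powerSeriesPartialSum ⟨z₀, Metric.mem_eball_self hr⟩ k f) atTop (𝓝 f) := by
  let _ : UniformSpace E := IsTopologicalAddGroup.rightUniformSpace E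
  have _ : IsUniformAddGroup E := isUniformAddGroup_of_addCommGroup
  rw [tendsto_subtype_rng, ContinuousMap.tendsto_iff_forall_isCompact_tendstoUniformlyOn]
  intro K hK
  obtain ⟨a, R, ha, haR, hKa, hRr⟩ := exists_closedBall_of_isCompact_subset_eball hr
    (Subtype.isCompact_iff.1 hK) (Subtype.coe_image_subset _ _)
  obtain ⟨ρ, haρ, hρR⟩ := exists_between haR
  obtain ⟨F, _, _, _, ι, g, hg, hfg⟩ := IsHolomorphic.exists_factorization hE Metric.isOpen_eball
    f.2 (ha.trans haρ) hρR hRr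
  have hU := tendstoUniformlyOn_taylorSeries ha haρ hg
  have hι := (ι.uniformContinuous.comp_tendstoUniformlyOn hU).comp
    (Subtype.val : Metric.eball z₀ r → ℂ)
  have hcoeff (n : ℕ) : iteratedComplexDeriv n f.1 ⟨z₀, Metric.mem_eball_self hr⟩ =
      ι (iteratedDeriv n g z₀) :=
    (iteratedComplexDeriv_eq_of_factorization Metric.isOpen_eball ι Metric.isOpen_ball hg hfg n
      ⟨z₀, Metric.mem_eball_self hr⟩ (Metric.mem_ball_self (ha.trans haρ))).1
  intro u hu
  -- The shift by one is needed because the `k`-th partial sum has `k + 1` terms.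
  filter_upwards [(tendsto_add_atTop_nat 1).eventually (hι u hu)] with k hk w hw
  have hwa : (w : ℂ) ∈ Metric.closedBall z₀ a := hKa ⟨w, hw, rfl⟩
  have h := hk w hwa
  simp only [Function.comp_apply, map_sum, map_smul] at h
  change (f.1 w, (powerSeriesPartialSum ⟨z₀, Metric.mem_eball_self hr⟩ k f).1 w) ∈ u
  rw [powerSeriesPartialSum_apply, hfg w (Metric.closedBall_subset_ball haρ hwa)]
  simpa only [hcoeff] using h

/-- The conditional summation filter is generated by initial segments, so this is convergence of the
partial sums rather than unconditional summability. -/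
theorem hasSum_powerSeriesTerm {E : Type*} [AddCommGroup E] [Module ℂ E]
    [TopologicalSpace E] [IsTopologicalAddGroup E] [ContinuousSMul ℂ E] [LocallyConvexSpace ℝ E]
    [T2Space E] (hE : IsLocallyComplete E) (z₀ : ℂ) {r : ℝ≥0∞} (hr : 0 < r)
    (f : HolomorphicFunctions (Metric.eball z₀ r) E) :
    HasSum (fun n : ℕ => powerSeriesTerm ⟨z₀, Metric.mem_eball_self hr⟩ n f) f
      (SummationFilter.conditional ℕ) := by
  rw [HasSum, SummationFilter.conditional_filter_eq_map_Iic, tendsto_map'_iff]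
  refine (tendsto_powerSeriesPartialSum hE z₀ hr f).congr fun k => ?_
  rw [powerSeriesPartialSum, Nat.range_succ_eq_Iic]
  rfl

end

theorem theorem4p5 {E : Type*} [AddCommGroup E] [Module ℂ E] [TopologicalSpace E]
    [IsTopologicalAddGroup E] [ContinuousSMul ℂ E] [LocallyConvexSpace ℝ E] [T2Space E]
    [Nontrivial E] (hE : IsLocallyComplete E) (z₀ : ℂ) (r : ℝ≥0∞) (hr : 0 < r) :
    -- all complex derivatives of holomorphic functions exist and are holomorphic
    (∀ f : HolomorphicFunctions (Metric.eball z₀ r) E, ∀ n : ℕ,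
      IsHolomorphic (iteratedComplexDeriv n f.1)) ∧
    IsSchauderDecomposition ℂ
      (fun (k : ℕ) (f : HolomorphicFunctions (Metric.eball z₀ r) E) =>
        powerSeriesPartialSum ⟨z₀, Metric.mem_eball_self hr⟩ k f) ∧
    ∀ f : HolomorphicFunctions (Metric.eball z₀ r) E,
      HasSum (fun n : ℕ => powerSeriesTerm ⟨z₀, Metric.mem_eball_self hr⟩ n f) f
        (SummationFilter.conditional ℕ) := by
  have hU : IsOpen (Metric.eball z₀ r) := Metric.isOpen_eball
  refine ⟨fun f n => IsHolomorphic.iteratedComplexDeriv hE hU f.2 n, ?_,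
    hasSum_powerSeriesTerm hE z₀ hr⟩
  refine ⟨fun k => ?_, fun k => ?_, fun k j => ?_, fun k j hkj => ?_,
    tendsto_powerSeriesPartialSum hE z₀ hr⟩
  · simp only [← powerSeriesPartialSumLinearMap_apply hE hU]
    exact (powerSeriesPartialSumLinearMap hE hU _ k).isLinear
  · exact continuous_finsetSum _ fun n _ => continuous_powerSeriesTerm hE hU _ n
  · funext f
    exact powerSeriesPartialSum_powerSeriesPartialSum hE hU _ k j f
  · rcases lt_or_gt_of_ne hkj with h | h
    · exact (powerSeriesPartialSum_ne_of_lt hU _ h).symm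
    · exact powerSeriesPartialSum_ne_of_lt hU _ h
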